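/- Let $n\ge 1$. For a locally integrable $f:\mathbb R^n\to\mathbb R$ and $x\in\mathbb R^n$ put $$MQf(x)=\sup_{r>0}\frac1{|B(x,r)|}\int_{B(x,r)}\frac{|f(z)-f(x)|}{|z-x|}\,dz\in[0,\infty],\qquad \mathcal M(h)(x)=\sup_{r>0}\frac1{|B(x,r)|}\int_{B(x,r)}|h(y)|\,dy\in[0,\infty],$$ where $B(x,r)$ is the open ball and $\mathcal M$ is the centred Hardy–Littlewood maximal function of a locally integrable $h$. For $1\le p\le\infty$ let $MQ^{1,p}(\mathbb R^n)$ be the class of all $f\in L^p(\mathbb R^n)$ with $MQf\in L^p(\mathbb R^n)$, and let $f^*(x)=\lim_{r\to0}\frac1{|B(x,r)|}\int_{B(x,r)}f\,dz$ at every $x$ where this limit exists in $\mathbb R$, $f^*(x)=f(x)$ elsewhere (the precise representative of $f$). (1) Let $1\le p\le\infty$ and let $f\in W^{1,p}_{\rm loc}(\mathbb R^n)$ be real valued with weak gradient $\nabla f$. Then $f^*=f$ almost everywhere, and for every $x\in\mathbb R^n$ $$MQf^*(x)\le\mathcal M(|\nabla f|)(x).$$ For an arbitrary representative $f$, the inequality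 $MQf(x)\le\mathcal M(|\nabla f|)(x)$ holds at every $x$ at which $f(x)=\lim_{r\to0}\frac1{|B(x,r)|}\int_{B(x,r)}f\,dz$ and, in particular, for almost every $x$. (2) For $1<p\le\infty$, $W^{1,p}(\mathbb R^n)\subset MQ^{1,p}(\mathbb R^n)$. -/

import Mathlib

open MeasureTheory Metric Filter
open scoped ENNReal ContDiff Topology Gradient

noncomputable section

/-- The averaged difference quotient of `f` at `x` over the open ball `B(x,r)`, with values in
`[0,∞]`. The integrand at `z = x` is `0 / 0 = 0`. -/
def meanQuotient {n : ℕ} (f : EuclideanSpace ℝ (Fin n) → ℝ) (r : ℝ)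
    (x : EuclideanSpace ℝ (Fin n)) : ℝ≥0∞ :=
  (volume (ball x r))⁻¹ * ∫⁻ z in ball x r, ‖f z - f x‖ₑ / ‖z - x‖ₑ

/-- The maximal mean difference quotient `MQf(x)`. -/
def MQ {n : ℕ} (f : EuclideanSpace ℝ (Fin n) → ℝ) (x : EuclideanSpace ℝ (Fin n)) : ℝ≥0∞ :=
  ⨆ (r : ℝ) (_ : 0 < r), meanQuotient f r x

/-- The centred Hardy–Littlewood maximal function. -/
def centredMaximal {n : ℕ} (h : EuclideanSpace ℝ (Fin n) → ℝ)
    (x : EuclideanSpace ℝ (Fin n)) : ℝ≥0∞ :=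
  ⨆ (r : ℝ) (_ : 0 < r), (volume (ball x r))⁻¹ * ∫⁻ y in ball x r, ‖h y‖ₑ

/-- `g` is a weak (distributional) gradient of `f` on `ℝⁿ`. -/
def HasWeakGradient {n : ℕ} (f : EuclideanSpace ℝ (Fin n) → ℝ)
    (g : EuclideanSpace ℝ (Fin n) → EuclideanSpace ℝ (Fin n)) : Prop :=
  LocallyIntegrable f ∧ LocallyIntegrable g ∧
    ∀ φ : EuclideanSpace ℝ (Fin n) → ℝ, ContDiff ℝ ∞ φ → HasCompactSupport φ →
      ∫ x, f x • ∇ φ x = - ∫ x, φ x • g x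

/-- `u` belongs to `Lᵖ` on every compact subset of `ℝⁿ`. -/
def MemLpLocal {n : ℕ} {F : Type*} [NormedAddCommGroup F] (p : ℝ≥0∞)
    (u : EuclideanSpace ℝ (Fin n) → F) : Prop :=
  ∀ K : Set (EuclideanSpace ℝ (Fin n)), IsCompact K → MemLp u p (volume.restrict K)

/-- The functions (all representatives) in `W^{1,p}_loc(ℝⁿ)`. -/
def sobolevLoc (n : ℕ) (p : ℝ≥0∞) : Set (EuclideanSpace ℝ (Fin n) → ℝ) :=
  {f | MemLpLocal p f ∧ ∃ g, HasWeakGradient f g ∧ MemLpLocal p g}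

/-- The functions (all representatives) in `W^{1,p}(ℝⁿ)`. -/
def sobolev (n : ℕ) (p : ℝ≥0∞) : Set (EuclideanSpace ℝ (Fin n) → ℝ) :=
  {f | MemLp f p ∧ ∃ g, HasWeakGradient f g ∧ MemLp g p}

/-- The class `MQ^{1,p}(ℝⁿ)`: functions in `Lᵖ` whose maximal mean difference quotient
(a `[0,∞]`-valued function) is in `Lᵖ`. -/
def mqSpace (n : ℕ) (p : ℝ≥0∞) : Set (EuclideanSpace ℝ (Fin n) → ℝ) :=
  {f | MemLp f p ∧ MemLp (MQ f) p}

/-- The averages of `f` over the balls `B(x,r)` converge to `c` as `r → 0`. -/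
def AveragesTendTo {n : ℕ} (f : EuclideanSpace ℝ (Fin n) → ℝ)
    (x : EuclideanSpace ℝ (Fin n)) (c : ℝ) : Prop :=
  Tendsto (fun r : ℝ => ⨍ z in ball x r, f z) (𝓝[>] 0) (𝓝 c)

open Classical in
/-- The precise representative of `f`: the limit of the averages of `f` over the balls `B(x,r)`
where this limit exists, and `f x` elsewhere. -/
def preciseRep {n : ℕ} (f : EuclideanSpace ℝ (Fin n) → ℝ)
    (x : EuclideanSpace ℝ (Fin n)) : ℝ :=
  if h : ∃ c, AveragesTendTo f x c then h.choose else f x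

end

/-!
Fix `x` and write `M` for the centred maximal function of the weak gradient `|g|` at `x`.

For a `C¹` function `u`, the difference `|u z - u (x + δ (z - x))| / |z - x|` is at most the
integral over `t ∈ [δ, 1]` of `|∇u|` at `x + t (z - x)`. Integrating in `z` over `B(x,r)` and
rescaling, the average over `B(x,r)` is at most the integral over `t ∈ [δ, 1]` of the averages of
`|∇u|` over `B(x,tr)`. For a function `f` with weak gradient `g` this passes to the limit along
mollifications: they converge to `f` almost everywhere, so that Fatou's lemma applies on the left,
and the integrals of their gradients over `B(x,s)` are at most the integrals of `|g|` over the
balls `B(x,s + ε)`, which suffices on the right because `t ≥ δ > 0`. Hence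
`|f z - f (x + δ (z - x))| / |z - x|` has average at most `M` over `B(x,r)`, with constant exactly
one (`HasWeakGradient.setLIntegral_sub_homothety_center_le`).

It remains to let `δ → 0`. If `M = ∞` there is nothing to prove. If `M < ∞`, the same estimate shows
that the averages of `f` over `B(x,r)` and `B(x,δr)` differ by at most `r M`, so they converge to
some `c` (`HasWeakGradient.exists_averagesTendTo`); in particular the precise representative is the
limit of the averages at every such point. A Poincaré inequality, obtained from the contractions by
the factor `1/2` about the points of the ball, bounds the mean oscillation of `f` over `B(x,s)` by a
multiple of `s M`. So `f (x + δ (z - x))` converges to `c` in `L¹` of the ball, and Fatou's lemma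
along a sequence `δ → 0` gives the bound `M` for the average of `|f z - c| / |z - x|`
(`HasWeakGradient.average_sub_div_le_centredMaximal`). At almost every `x` the averages converge to
`f x` by Lebesgue's differentiation theorem.

The inclusion for `p > 1` follows from the pointwise bound, the measurability of `MQ f`
(`aemeasurable_MQ`) and the Hardy–Littlewood maximal theorem (`memLp_of_ae_le_centredMaximal`),
which is proved from Vitali's covering lemma and the layer cake formula.
-/

/-! ### Mollification of functions with a weak gradient -/

section Mollification

open scoped Convolution

/-- The gradient of the mollification of `f` is the mollification of the weak gradient of `f`:
the weak gradient is tested against the translated and reflected kernel. -/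
theorem fderiv_mollification_apply {n : ℕ} {f : EuclideanSpace ℝ (Fin n) → ℝ}
    {g : EuclideanSpace ℝ (Fin n) → EuclideanSpace ℝ (Fin n)} (h : HasWeakGradient f g)
    (φ : ContDiffBump (0 : EuclideanSpace ℝ (Fin n))) (x v : EuclideanSpace ℝ (Fin n)) :
    fderiv ℝ (φ.normed volume ⋆ f) x v =
      inner ℝ (∫ y, φ.normed volume (x - y) • g y) v := by
  obtain ⟨hf, hg, hfg⟩ := h
  have hψ : ContDiff ℝ ∞ (φ.normed volume) := φ.contDiff_normed
  have hψs : HasCompactSupport (φ.normed volume) := φ.hasCompactSupport_normed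
  have hcs : HasCompactSupport (fun y => φ.normed volume (x - y)) :=
    hψs.comp_homeomorph (Homeomorph.subLeft x)
  have hcd : ContDiff ℝ ∞ (fun y => φ.normed volume (x - y)) :=
    hψ.comp (contDiff_const.sub contDiff_id)
  have hder : ∀ y, fderiv ℝ (fun y => φ.normed volume (x - y)) y =
      - fderiv ℝ (φ.normed volume) (x - y) := fun y => by
    have := ((hψ.differentiable (by simp)).differentiableAt (x := x - y)).hasFDerivAt.comp y
      ((hasFDerivAt_id y).const_sub x)
    refine (HasFDerivAt.fderiv this).trans ?_
    ext v
    simp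
  have hgradc : Continuous (∇ (fun y => φ.normed volume (x - y))) :=
    (InnerProductSpace.toDual ℝ _).symm.continuous.comp (hcd.continuous_fderiv (by simp))
  have hgrads : HasCompactSupport (∇ (fun y => φ.normed volume (x - y))) :=
    (hcs.fderiv ℝ).comp_left (g := (InnerProductSpace.toDual ℝ _).symm) (map_zero _)
  have hint : Integrable (fun y => f y • ∇ (fun y => φ.normed volume (x - y)) y) :=
    hf.integrable_smul_right_of_hasCompactSupport hgradc hgrads
  have hL : Integrable (fun y => (ContinuousLinearMap.precompL (EuclideanSpace ℝ (Fin n))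
      (ContinuousLinearMap.lsmul ℝ ℝ)) (fderiv ℝ (φ.normed volume) (x - y)) (f y)) :=
    ((hψs.fderiv ℝ).convolutionExists_left _ (hψ.continuous_fderiv (by simp)) hf
      x).integrable_swap
  rw [(hψs.hasFDerivAt_convolution_left _ (hψ.of_le (by simp)) hf x).fderiv, convolution_eq_swap,
    ContinuousLinearMap.integral_apply hL]
  have key := congrArg (fun w => inner ℝ w v) (hfg _ hcd hcs)
  simp only [inner_neg_left] at key
  rw [← neg_eq_iff_eq_neg] at key
  rw [← key, real_inner_comm, ← integral_inner hint, ← integral_neg]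
  refine integral_congr_ae (Eventually.of_forall fun y => ?_)
  simp only [ContinuousLinearMap.precompL_apply, ContinuousLinearMap.lsmul_apply,
    real_inner_smul_left, real_inner_comm _ v, inner_gradient_left, hder, smul_eq_mul, neg_apply]
  ring

theorem enorm_fderiv_mollification_le {n : ℕ} {f : EuclideanSpace ℝ (Fin n) → ℝ}
    {g : EuclideanSpace ℝ (Fin n) → EuclideanSpace ℝ (Fin n)} (h : HasWeakGradient f g)
    (φ : ContDiffBump (0 : EuclideanSpace ℝ (Fin n))) (x : EuclideanSpace ℝ (Fin n)) :
    ‖fderiv ℝ (φ.normed volume ⋆ f) x‖ₑ ≤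
      ∫⁻ y, ‖φ.normed volume (x - y)‖ₑ * ‖g y‖ₑ := by
  have : fderiv ℝ (φ.normed volume ⋆ f) x =
      innerSL ℝ (∫ y, φ.normed volume (x - y) • g y) := by
    ext v
    rw [fderiv_mollification_apply h, innerSL_apply_apply]
  rw [this, enorm_eq_iff_norm_eq.2 (innerSL_apply_norm ℝ _)]
  refine (enorm_integral_le_lintegral_enorm _).trans (lintegral_mono fun y => ?_)
  rw [enorm_smul]

theorem ContDiffBump.lintegral_enorm_normed {n : ℕ}
    (φ : ContDiffBump (0 : EuclideanSpace ℝ (Fin n))) :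
    ∫⁻ y, ‖φ.normed volume y‖ₑ = 1 := by
  rw [← ofReal_integral_norm_eq_lintegral_enorm φ.integrable_normed]
  simp_rw [Real.norm_of_nonneg (φ.nonneg_normed _)]
  rw [φ.integral_normed, ENNReal.ofReal_one]

/-- The integral of the gradient of the mollification over a ball is controlled by the integral of
the weak gradient over the ball enlarged by the radius of the mollifier. -/
theorem setLIntegral_fderiv_mollification_le {n : ℕ} {f : EuclideanSpace ℝ (Fin n) → ℝ}
    {g : EuclideanSpace ℝ (Fin n) → EuclideanSpace ℝ (Fin n)} (h : HasWeakGradient f g)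
    (φ : ContDiffBump (0 : EuclideanSpace ℝ (Fin n))) (x : EuclideanSpace ℝ (Fin n)) (s : ℝ) :
    ∫⁻ z in ball x s, ‖fderiv ℝ (φ.normed volume ⋆ f) z‖ₑ ≤
      ∫⁻ y in ball x (s + φ.rOut), ‖g y‖ₑ := by
  have hm : AEMeasurable (fun y => ‖g y‖ₑ) volume := h.2.1.aestronglyMeasurable.enorm
  have hψm : Measurable (fun y => ‖φ.normed volume y‖ₑ) :=
    (φ.continuous_normed (μ := volume)).enorm.measurable
  calc ∫⁻ z in ball x s, ‖fderiv ℝ (φ.normed volume ⋆ f) z‖ₑ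
      ≤ ∫⁻ z in ball x s, ∫⁻ y, ‖φ.normed volume (z - y)‖ₑ * ‖g y‖ₑ :=
        lintegral_mono fun z => enorm_fderiv_mollification_le h φ z
    _ = ∫⁻ y, ∫⁻ z in ball x s, ‖φ.normed volume (z - y)‖ₑ * ‖g y‖ₑ := by
        exact lintegral_lintegral_swap
          ((hψm.comp (measurable_fst.sub measurable_snd)).aemeasurable.mul hm.comp_snd)
    _ ≤ ∫⁻ y, (ball x (s + φ.rOut)).indicator (fun y => ‖g y‖ₑ) y := by
        refine lintegral_mono fun y => ?_
        by_cases hy : y ∈ ball x (s + φ.rOut)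
        · rw [Set.indicator_of_mem hy]
          refine (setLIntegral_le_lintegral _ _).trans ?_
          have hψy : Measurable fun z => ‖φ.normed volume (z - y)‖ₑ :=
            hψm.comp (measurable_id.sub_const y)
          rw [lintegral_mul_const _ hψy,
            lintegral_sub_right_eq_self (fun z => ‖φ.normed volume z‖ₑ) y,
            φ.lintegral_enorm_normed, one_mul]
        · rw [Set.indicator_of_notMem hy]
          refine le_of_eq ((setLIntegral_congr_fun measurableSet_ball fun z hz => ?_).trans
            lintegral_zero)
          have : φ.normed volume (z - y) = 0 := by
            rw [← Function.notMem_support, φ.support_normed_eq, mem_ball_zero_iff, not_lt]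
            rw [mem_ball, not_lt] at hy
            rw [mem_ball] at hz
            have := dist_triangle_left y x z
            rw [← dist_eq_norm]
            linarith
          simp [this]
    _ = ∫⁻ y in ball x (s + φ.rOut), ‖g y‖ₑ := lintegral_indicator measurableSet_ball _

/-- Approximation of a function with a weak gradient by `C¹` functions, almost everywhere, with the
one-sided control of the gradients over balls that replaces their convergence in `L¹_loc`. -/
theorem HasWeakGradient.exists_contDiff_approx {n : ℕ} {f : EuclideanSpace ℝ (Fin n) → ℝ}
    {g : EuclideanSpace ℝ (Fin n) → EuclideanSpace ℝ (Fin n)} (h : HasWeakGradient f g) :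
    ∃ u : ℕ → EuclideanSpace ℝ (Fin n) → ℝ, (∀ k, ContDiff ℝ 1 (u k)) ∧
      (∀ᵐ x, Tendsto (fun k => u k x) atTop (𝓝 (f x))) ∧
      ∀ k x s, ∫⁻ z in ball x s, ‖fderiv ℝ (u k) z‖ₑ ≤
        ∫⁻ y in ball x (s + 1 / ((k : ℝ) + 1)), ‖g y‖ₑ := by
  let φ : ℕ → ContDiffBump (0 : EuclideanSpace ℝ (Fin n)) := fun k =>
    ⟨1 / ((k : ℝ) + 1) / 2, 1 / ((k : ℝ) + 1), by positivity, half_lt_self (by positivity)⟩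
  refine ⟨fun k => (φ k).normed volume ⋆ f, fun k => ?_, ?_, fun k x s =>
    setLIntegral_fderiv_mollification_le h (φ k) x s⟩
  · exact (φ k).hasCompactSupport_normed.contDiff_convolution_left (n := 1) _
      (φ k).contDiff_normed h.1
  · refine ContDiffBump.ae_convolution_tendsto_right_of_locallyIntegrable (K := 2)
      tendsto_one_div_add_atTop_nhds_zero_nat (Eventually.of_forall fun k => ?_) h.1
    change 1 / ((k : ℝ) + 1) ≤ 2 * (1 / ((k : ℝ) + 1) / 2)
    linarith

end Mollification

/-! ### Homotheties and difference quotients of limits of `C¹` functions -/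

theorem AffineMap.homothety_injective_of_ne_zero {E : Type*} [AddCommGroup E] [Module ℝ E]
    (x : E) {t : ℝ} (ht : t ≠ 0) : Function.Injective (AffineMap.homothety x t : E → E) := by
  intro a b hab
  simpa [AffineMap.homothety_apply, ht] using hab

theorem AffineMap.homothety_image_ball {E : Type*} [NormedAddCommGroup E] [NormedSpace ℝ E]
    (x : E) {t : ℝ} (ht : 0 < t) (r : ℝ) :
    AffineMap.homothety x t '' ball x r = ball x (t * r) := by
  ext y
  constructor
  · rintro ⟨z, hz, rfl⟩
    rw [mem_ball_iff_norm] at hz ⊢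
    simpa [AffineMap.homothety_apply, norm_smul, abs_of_pos ht] using mul_lt_mul_of_pos_left hz ht
  · intro hy
    refine ⟨AffineMap.homothety x t⁻¹ y, ?_, ?_⟩
    · rw [mem_ball_iff_norm] at hy ⊢
      simp only [AffineMap.homothety_apply, vsub_eq_sub, vadd_eq_add, add_sub_cancel_right,
        norm_smul, norm_inv, Real.norm_eq_abs, abs_of_pos ht]
      rwa [inv_mul_lt_iff₀ ht]
    · simp [AffineMap.homothety_apply, smul_smul, ht.ne']

theorem AffineMap.homothety_image_ball_subset {E : Type*} [NormedAddCommGroup E] [NormedSpace ℝ E]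
    {x w : E} {s t : ℝ} (hw : w ∈ ball x s) (ht₀ : 0 ≤ t) (ht₁ : t ≤ 1) :
    AffineMap.homothety w t '' ball x s ⊆ ball x s := by
  rintro _ ⟨z, hz, rfl⟩
  rw [AffineMap.homothety_eq_lineMap]
  exact (convex_ball x s).lineMap_mem hw hz ⟨ht₀, ht₁⟩

/-- The fundamental theorem of calculus along the segment from `homothety w δ z` to `z`. -/
theorem enorm_sub_comp_homothety_le {E : Type*} [NormedAddCommGroup E] [NormedSpace ℝ E]
    {u : E → ℝ} (hu : ContDiff ℝ 1 u) (w z : E) {δ : ℝ}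
    (hδ : δ ≤ 1) :
    ‖u z - u (AffineMap.homothety w δ z)‖ₑ ≤
      (∫⁻ t in Set.Icc δ 1, ‖fderiv ℝ u (AffineMap.homothety w t z)‖ₑ) * ‖z - w‖ₑ := by
  have hd : ∀ t : ℝ, HasDerivAt (fun t : ℝ => AffineMap.homothety w t z) (z - w) t := fun t => by
    simpa [AffineMap.homothety_apply] using
      ((hasDerivAt_id t).smul_const (z - w)).add_const w
  have hc : ContDiff ℝ 1 (fun t : ℝ => u (AffineMap.homothety w t z)) := by
    refine hu.comp ?_
    simp only [AffineMap.homothety_apply, vsub_eq_sub, vadd_eq_add]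
    fun_prop
  have hderiv : ∀ t, deriv (fun t : ℝ => u (AffineMap.homothety w t z)) t =
      fderiv ℝ u (AffineMap.homothety w t z) (z - w) := fun t =>
    (((hu.differentiable (by simp)).differentiableAt.hasFDerivAt).comp_hasDerivAt t (hd t)).deriv
  have := enorm_sub_le_lintegral_deriv_of_contDiffOn_Icc hc.contDiffOn hδ
  simp only [AffineMap.homothety_one, AffineMap.id_apply, hderiv] at this
  refine this.trans ?_
  rw [← lintegral_mul_const']
  · exact lintegral_mono fun t => ContinuousLinearMap.le_opENorm _ _
  · exact enorm_ne_top

section Haar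

variable {E : Type*} [NormedAddCommGroup E] [NormedSpace ℝ E] [FiniteDimensional ℝ E]
  [MeasurableSpace E] [BorelSpace E] (μ : Measure E) [μ.IsAddHaarMeasure]

theorem AffineMap.measurableEmbedding_homothety (x : E) {t : ℝ} (ht : t ≠ 0) :
    MeasurableEmbedding (AffineMap.homothety x t : E → E) :=
  (AffineMap.homothety_continuous x t).measurableEmbedding
    (AffineMap.homothety_injective_of_ne_zero x ht)

theorem MeasureTheory.Measure.map_homothety (x : E) {t : ℝ} (ht : t ≠ 0) :
    μ.map (AffineMap.homothety x t) = ENNReal.ofReal |(t ^ Module.finrank ℝ E)⁻¹| • μ := by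
  have : (AffineMap.homothety x t : E → E) = (· + x) ∘ (t • ·) ∘ (· - x) := by
    ext z
    simp [AffineMap.homothety_apply]
  rw [this, ← Measure.map_map (measurable_add_const x) (by fun_prop),
    ← Measure.map_map (measurable_const_smul t) (by fun_prop)]
  rw [(measurePreserving_sub_right μ x).map_eq, Measure.map_addHaar_smul μ ht, Measure.map_smul,
    map_add_right_eq_self]

theorem MeasureTheory.Measure.map_restrict_homothety (x : E) {t : ℝ} (ht : t ≠ 0) (S : Set E) :
    (μ.restrict S).map (AffineMap.homothety x t) =
      ENNReal.ofReal |(t ^ Module.finrank ℝ E)⁻¹| •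
        μ.restrict (AffineMap.homothety x t '' S) := by
  rw [← Measure.restrict_smul, ← μ.map_homothety x ht,
    (AffineMap.measurableEmbedding_homothety x ht).restrict_map,
    (AffineMap.homothety_injective_of_ne_zero x ht).preimage_image]

theorem MeasureTheory.Measure.quasiMeasurePreserving_homothety (x : E) {t : ℝ} (ht : t ≠ 0) :
    Measure.QuasiMeasurePreserving (AffineMap.homothety x t) μ μ :=
  ⟨(AffineMap.homothety_continuous x t).measurable, by
    rw [μ.map_homothety x ht]; exact Measure.smul_absolutelyContinuous⟩

theorem setLIntegral_comp_homothety (x : E) {t : ℝ} (ht : t ≠ 0) (S : Set E) (F : E → ℝ≥0∞) :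
    ∫⁻ z in S, F (AffineMap.homothety x t z) ∂μ =
      ENNReal.ofReal |(t ^ Module.finrank ℝ E)⁻¹| *
        ∫⁻ z in AffineMap.homothety x t '' S, F z ∂μ := by
  rw [← (AffineMap.measurableEmbedding_homothety x ht).lintegral_map,
    μ.map_restrict_homothety x ht, lintegral_smul_measure, smul_eq_mul]

theorem setAverage_comp_homothety {F : Type*} [NormedAddCommGroup F] [NormedSpace ℝ F]
    (x : E) {t : ℝ} (ht : t ≠ 0) (S : Set E) (f : E → F) :
    ⨍ z in S, f (AffineMap.homothety x t z) ∂μ =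
      ⨍ z in AffineMap.homothety x t '' S, f z ∂μ := by
  have hc : |(t ^ Module.finrank ℝ E)⁻¹| ≠ 0 := abs_ne_zero.2 (inv_ne_zero (pow_ne_zero _ ht))
  rw [setAverage_eq, setAverage_eq, ← (AffineMap.measurableEmbedding_homothety x ht).integral_map,
    μ.map_restrict_homothety x ht, integral_smul_measure, smul_smul, measureReal_def,
    measureReal_def, Measure.addHaar_image_homothety, ENNReal.toReal_mul,
    ENNReal.toReal_ofReal (abs_nonneg _), ENNReal.toReal_ofReal (abs_nonneg _), abs_inv, mul_inv,
    mul_comm]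

theorem setLIntegral_sub_comp_homothety_div_le {u : E → ℝ} (hu : ContDiff ℝ 1 u) (w : E)
    (S : Set E) {δ : ℝ} (hδ₀ : 0 < δ) (hδ : δ ≤ 1) :
    ∫⁻ z in S, ‖u z - u (AffineMap.homothety w δ z)‖ₑ / ‖z - w‖ₑ ∂μ ≤
      ∫⁻ t in Set.Icc δ 1, ENNReal.ofReal |(t ^ Module.finrank ℝ E)⁻¹| *
        ∫⁻ z in AffineMap.homothety w t '' S, ‖fderiv ℝ u z‖ₑ ∂μ := by
  calc ∫⁻ z in S, ‖u z - u (AffineMap.homothety w δ z)‖ₑ / ‖z - w‖ₑ ∂μ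
      ≤ ∫⁻ z in S, (∫⁻ t in Set.Icc δ 1, ‖fderiv ℝ u (AffineMap.homothety w t z)‖ₑ) ∂μ :=
        lintegral_mono fun z => ENNReal.div_le_of_le_mul (enorm_sub_comp_homothety_le hu w z hδ)
    _ = ∫⁻ t in Set.Icc δ 1, ∫⁻ z in S, ‖fderiv ℝ u (AffineMap.homothety w t z)‖ₑ ∂μ := by
        refine lintegral_lintegral_swap (Continuous.aemeasurable ?_)
        refine ((hu.continuous_fderiv (by simp)).comp ?_).enorm
        simp only [AffineMap.homothety_apply, vsub_eq_sub, vadd_eq_add]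
        fun_prop
    _ = _ := setLIntegral_congr_fun measurableSet_Icc fun t ht =>
        setLIntegral_comp_homothety μ w (hδ₀.trans_le ht.1).ne' S (fun z => ‖fderiv ℝ u z‖ₑ)

/-- Fatou's lemma turns the estimate for `C¹` functions into one for their almost everywhere limit.
No convergence of the gradients is involved. -/
theorem setLIntegral_sub_comp_homothety_div_le_liminf [Nontrivial E] {u : ℕ → E → ℝ}
    (hu : ∀ k, ContDiff ℝ 1 (u k)) {f : E → ℝ}
    (huf : ∀ᵐ x ∂μ, Tendsto (fun k => u k x) atTop (𝓝 (f x))) (w : E)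
    (S : Set E) {δ : ℝ} (hδ₀ : 0 < δ) (hδ : δ ≤ 1) :
    ∫⁻ z in S, ‖f z - f (AffineMap.homothety w δ z)‖ₑ / ‖z - w‖ₑ ∂μ ≤
      liminf (fun k => ∫⁻ t in Set.Icc δ 1, ENNReal.ofReal |(t ^ Module.finrank ℝ E)⁻¹| *
        ∫⁻ z in AffineMap.homothety w t '' S, ‖fderiv ℝ (u k) z‖ₑ ∂μ) atTop := by
  calc ∫⁻ z in S, ‖f z - f (AffineMap.homothety w δ z)‖ₑ / ‖z - w‖ₑ ∂μ
      = ∫⁻ z in S, liminf (fun k =>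
          ‖u k z - u k (AffineMap.homothety w δ z)‖ₑ / ‖z - w‖ₑ) atTop ∂μ := by
        refine lintegral_congr_ae (ae_restrict_of_ae ?_)
        filter_upwards [huf, (μ.quasiMeasurePreserving_homothety w hδ₀.ne').ae huf,
          compl_mem_ae_iff.2 (measure_singleton w)] with z hz hz' hne
        refine (Tendsto.liminf_eq (ENNReal.Tendsto.div_const (hz.sub hz').enorm (Or.inr ?_))).symm
        exact enorm_ne_zero.2 (sub_ne_zero.2 hne)
    _ ≤ liminf (fun k => ∫⁻ z in S,
          ‖u k z - u k (AffineMap.homothety w δ z)‖ₑ / ‖z - w‖ₑ ∂μ) atTop := by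
        refine lintegral_liminf_le' fun k => (Measurable.div ?_ ?_).aemeasurable
        · exact ((hu k).continuous.sub
            ((hu k).continuous.comp (AffineMap.homothety_continuous w δ))).enorm.measurable
        · exact (continuous_id.sub continuous_const).enorm.measurable
    _ ≤ _ := liminf_le_liminf (Eventually.of_forall fun k =>
        setLIntegral_sub_comp_homothety_div_le μ (hu k) w S hδ₀ hδ)

end Haar

/-! ### Dilations of functions with a weak gradient -/

section Haar

variable {E : Type*} [NormedAddCommGroup E] [NormedSpace ℝ E] [FiniteDimensional ℝ E]
  [MeasurableSpace E] [BorelSpace E] (μ : Measure E) [μ.IsAddHaarMeasure]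

theorem enorm_setAverage_le {α F : Type*} [MeasurableSpace α] [NormedAddCommGroup F]
    [NormedSpace ℝ F] (μ : Measure α) (S : Set α) (h : α → F) :
    ‖⨍ z in S, h z ∂μ‖ₑ ≤ (μ S)⁻¹ * ∫⁻ z in S, ‖h z‖ₑ ∂μ := by
  refine (enorm_integral_le_lintegral_enorm _).trans_eq ?_
  rw [lintegral_smul_measure, Measure.restrict_apply_univ, smul_eq_mul]

theorem tendsto_measure_ball_add [Nontrivial E] (x : E) {r : ℝ} (hr : 0 ≤ r) {ε : ℕ → ℝ}
    (hε₀ : ∀ k, 0 ≤ ε k) (hε : Tendsto ε atTop (𝓝 0)) :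
    Tendsto (fun k => μ (ball x (r + ε k))) atTop (𝓝 (μ (ball x r))) := by
  simp_rw [Measure.addHaar_ball μ x hr, fun k => Measure.addHaar_ball μ x (add_nonneg hr (hε₀ k))]
  refine ENNReal.Tendsto.mul_const (ENNReal.tendsto_ofReal ?_) (Or.inr measure_ball_lt_top.ne)
  simpa using (tendsto_const_nhds.add hε).pow (Module.finrank ℝ E)

end Haar

theorem setLIntegral_ball_le_centredMaximal {n : ℕ} (h : EuclideanSpace ℝ (Fin n) → ℝ)
    (x : EuclideanSpace ℝ (Fin n)) {r : ℝ} (hr : 0 < r) :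
    ∫⁻ y in ball x r, ‖h y‖ₑ ≤ centredMaximal h x * volume (ball x r) := by
  have hle : (volume (ball x r))⁻¹ * ∫⁻ y in ball x r, ‖h y‖ₑ ≤ centredMaximal h x :=
    le_iSup₂ (f := fun (r : ℝ) (_ : 0 < r) =>
      (volume (ball x r))⁻¹ * ∫⁻ y in ball x r, ‖h y‖ₑ) r hr
  have h0 : volume (ball x r) ≠ 0 := (measure_ball_pos volume x hr).ne'
  have ht : volume (ball x r) ≠ ⊤ := measure_ball_lt_top.ne
  calc ∫⁻ y in ball x r, ‖h y‖ₑ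
      = ((volume (ball x r))⁻¹ * ∫⁻ y in ball x r, ‖h y‖ₑ) * volume (ball x r) := by
        rw [mul_right_comm, ENNReal.inv_mul_cancel h0 ht, one_mul]
    _ ≤ _ := by gcongr

section WeakGradient

variable {n : ℕ} {f : EuclideanSpace ℝ (Fin n) → ℝ}
  {g : EuclideanSpace ℝ (Fin n) → EuclideanSpace ℝ (Fin n)}

/-- Comparison of `f` with its dilation about the centre `x`. The constant is exactly the centred
maximal function at `x`, since homotheties about `x` preserve averages over balls centred at `x`. -/
theorem HasWeakGradient.setLIntegral_sub_homothety_center_le (hn : 1 ≤ n)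
    (h : HasWeakGradient f g) (x : EuclideanSpace ℝ (Fin n)) {r δ : ℝ} (hr : 0 < r)
    (hδ₀ : 0 < δ) (hδ : δ ≤ 1) :
    ∫⁻ z in ball x r, ‖f z - f (AffineMap.homothety x δ z)‖ₑ / ‖z - x‖ₑ ≤
      centredMaximal (fun y => ‖g y‖) x * volume (ball x r) := by
  have : Nonempty (Fin n) := ⟨⟨0, hn⟩⟩
  obtain ⟨u, hu, huf, hug⟩ := h.exists_contDiff_approx
  refine (setLIntegral_sub_comp_homothety_div_le_liminf volume hu huf x (ball x r)
    hδ₀ hδ).trans ?_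
  have hlim : Tendsto (fun k : ℕ => centredMaximal (fun y => ‖g y‖) x *
      volume (ball x (r + 1 / ((k : ℝ) + 1) / δ))) atTop
      (𝓝 (centredMaximal (fun y => ‖g y‖) x * volume (ball x r))) := by
    refine ENNReal.Tendsto.const_mul (tendsto_measure_ball_add volume x hr.le
      (fun k => by positivity) ?_) (Or.inl (measure_ball_pos volume x hr).ne')
    simpa using tendsto_one_div_add_atTop_nhds_zero_nat.div_const δ
  rw [← hlim.liminf_eq]
  refine liminf_le_liminf (Eventually.of_forall fun k => ?_)
  have hε : (0 : ℝ) < 1 / ((k : ℝ) + 1) := by positivity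
  calc _ ≤ ∫⁻ t in Set.Icc δ 1, centredMaximal (fun y => ‖g y‖) x *
          volume (ball x (r + 1 / ((k : ℝ) + 1) / δ)) := by
        refine setLIntegral_mono' measurableSet_Icc fun t ht => ?_
        have ht₀ : 0 < t := hδ₀.trans_le ht.1
        have hc : 0 < t ^ Module.finrank ℝ (EuclideanSpace ℝ (Fin n)) := pow_pos ht₀ _
        -- Dilation by `1 / t ≤ 1 / δ` turns the enlarged ball into one close to `B(x,r)`.
        have hball : volume (ball x (t * r + 1 / ((k : ℝ) + 1))) =
            ENNReal.ofReal (t ^ Module.finrank ℝ (EuclideanSpace ℝ (Fin n))) *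
              volume (ball x (r + 1 / ((k : ℝ) + 1) / t)) := by
          rw [Measure.addHaar_ball_center volume x (r + _),
            ← Measure.addHaar_ball_mul_of_pos volume x ht₀]
          congr 2
          field_simp
        calc _ ≤ ENNReal.ofReal |(t ^ Module.finrank ℝ (EuclideanSpace ℝ (Fin n)))⁻¹| *
              (centredMaximal (fun y => ‖g y‖) x *
                volume (ball x (t * r + 1 / ((k : ℝ) + 1)))) := by
              gcongr
              rw [AffineMap.homothety_image_ball x ht₀]
              refine (hug k x (t * r)).trans ?_
              simpa using setLIntegral_ball_le_centredMaximal (fun y => ‖g y‖) x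
                (add_pos (mul_pos ht₀ hr) hε)
          _ = centredMaximal (fun y => ‖g y‖) x *
                volume (ball x (r + 1 / ((k : ℝ) + 1) / t)) := by
              rw [hball, mul_left_comm, ← mul_assoc (ENNReal.ofReal _), abs_of_pos (inv_pos.2 hc),
                ← ENNReal.ofReal_mul (inv_pos.2 hc).le, inv_mul_cancel₀ hc.ne', ENNReal.ofReal_one,
                one_mul]
          _ ≤ _ := by
              gcongr
              exact ht.1
    _ ≤ _ := by
        rw [setLIntegral_const, Real.volume_Icc]
        refine mul_le_of_le_one_right' ?_
        rw [ENNReal.ofReal_le_one]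
        linarith

/-- Comparison of `f` with its contraction by the factor `1/2` about a point `w` of the ball. -/
theorem HasWeakGradient.setLIntegral_sub_homothety_half_le (hn : 1 ≤ n)
    (h : HasWeakGradient f g) {x w : EuclideanSpace ℝ (Fin n)} {s : ℝ} (hw : w ∈ ball x s) :
    ∫⁻ z in ball x s, ‖f z - f (AffineMap.homothety w (1 / 2 : ℝ) z)‖ₑ ≤
      ENNReal.ofReal (2 * s) * (ENNReal.ofReal (2 ^ n) *
        (centredMaximal (fun y => ‖g y‖) x * volume (ball x s))) := by
  have : Nonempty (Fin n) := ⟨⟨0, hn⟩⟩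
  have hs : 0 < s := pos_of_mem_ball hw
  obtain ⟨u, hu, huf, hug⟩ := h.exists_contDiff_approx
  calc ∫⁻ z in ball x s, ‖f z - f (AffineMap.homothety w (1 / 2 : ℝ) z)‖ₑ
      ≤ ∫⁻ z in ball x s, ENNReal.ofReal (2 * s) *
          (‖f z - f (AffineMap.homothety w (1 / 2 : ℝ) z)‖ₑ / ‖z - w‖ₑ) := by
        refine setLIntegral_mono' measurableSet_ball fun z hz => ?_
        -- At the centre of the homothety both sides vanish, because `0 / 0 = 0`.
        rcases eq_or_ne z w with rfl | hne
        · simp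
        · have h0 : ‖z - w‖ₑ ≠ 0 := enorm_ne_zero.2 (sub_ne_zero.2 hne)
          calc _ = ‖z - w‖ₑ * (‖f z - f (AffineMap.homothety w (1 / 2 : ℝ) z)‖ₑ / ‖z - w‖ₑ) :=
                (ENNReal.mul_div_cancel h0 enorm_ne_top).symm
            _ ≤ _ := by
                gcongr
                rw [← ofReal_norm, ← dist_eq_norm]
                refine ENNReal.ofReal_le_ofReal ?_
                linarith [dist_triangle_right z w x, mem_ball.1 hz, mem_ball.1 hw]
    _ = ENNReal.ofReal (2 * s) * ∫⁻ z in ball x s,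
          (‖f z - f (AffineMap.homothety w (1 / 2 : ℝ) z)‖ₑ / ‖z - w‖ₑ) :=
        lintegral_const_mul' _ _ ENNReal.ofReal_ne_top
    _ ≤ _ := by
        gcongr
        refine (setLIntegral_sub_comp_homothety_div_le_liminf volume hu huf w (ball x s)
          (by norm_num : (0 : ℝ) < 1 / 2) (by norm_num)).trans ?_
        have hlim : Tendsto (fun k : ℕ => ENNReal.ofReal (2 ^ n) *
            (centredMaximal (fun y => ‖g y‖) x * volume (ball x (s + 1 / ((k : ℝ) + 1))))) atTop
            (𝓝 (ENNReal.ofReal (2 ^ n) *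
              (centredMaximal (fun y => ‖g y‖) x * volume (ball x s)))) := by
          refine ENNReal.Tendsto.const_mul (ENNReal.Tendsto.const_mul
            (tendsto_measure_ball_add volume x hs.le (fun k => by positivity)
              tendsto_one_div_add_atTop_nhds_zero_nat)
            (Or.inl (measure_ball_pos volume x hs).ne')) (Or.inr ENNReal.ofReal_ne_top)
        rw [← hlim.liminf_eq]
        refine liminf_le_liminf (Eventually.of_forall fun k => ?_)
        calc _ ≤ ∫⁻ t in Set.Icc (1 / 2 : ℝ) 1, ENNReal.ofReal (2 ^ n) *
              (centredMaximal (fun y => ‖g y‖) x *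
                volume (ball x (s + 1 / ((k : ℝ) + 1)))) := by
              refine setLIntegral_mono' measurableSet_Icc fun t ht => ?_
              have ht₀ : 0 < t := lt_of_lt_of_le (by norm_num) ht.1
              gcongr
              · rw [finrank_euclideanSpace_fin, abs_of_pos (inv_pos.2 (pow_pos ht₀ _)), ← inv_pow]
                gcongr
                rw [inv_le_comm₀ ht₀ two_pos]
                simpa using ht.1
              · refine (lintegral_mono_set
                  (AffineMap.homothety_image_ball_subset hw ht₀.le ht.2)).trans ?_
                refine (hug k x s).trans ?_
                simpa using setLIntegral_ball_le_centredMaximal (fun y => ‖g y‖) x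
                  (by positivity : 0 < s + 1 / ((k : ℝ) + 1))
          _ ≤ _ := by
              rw [setLIntegral_const, Real.volume_Icc]
              refine mul_le_of_le_one_right' ?_
              rw [ENNReal.ofReal_le_one]
              norm_num

/-! ### Mean oscillation and convergence of averages -/

theorem LocallyIntegrable.integrableOn_ball (hf : LocallyIntegrable f)
    (x : EuclideanSpace ℝ (Fin n)) (r : ℝ) : IntegrableOn f (ball x r) :=
  (hf.integrableOn_isCompact (isCompact_closedBall x r)).mono_set ball_subset_closedBall

/-- A Poincaré inequality for the double integral of `f z - f w`. The two points are compared with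
their midpoint, so that only contractions by the factor `1/2` occur. -/
theorem HasWeakGradient.setLIntegral_setLIntegral_sub_le (hn : 1 ≤ n)
    (h : HasWeakGradient f g) (hf : Measurable f) (x : EuclideanSpace ℝ (Fin n)) (s : ℝ) :
    ∫⁻ w in ball x s, ∫⁻ z in ball x s, ‖f z - f w‖ₑ ≤
      2 * (ENNReal.ofReal (2 * s) * (ENNReal.ofReal (2 ^ n) *
        (centredMaximal (fun y => ‖g y‖) x * volume (ball x s))) * volume (ball x s)) := by
  set K := ENNReal.ofReal (2 * s) * (ENNReal.ofReal (2 ^ n) *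
        (centredMaximal (fun y => ‖g y‖) x * volume (ball x s)))
  have hcont : Continuous fun p : EuclideanSpace ℝ (Fin n) × EuclideanSpace ℝ (Fin n) =>
      AffineMap.homothety p.1 (1 / 2 : ℝ) p.2 := by
    simp only [AffineMap.homothety_apply, vsub_eq_sub, vadd_eq_add]
    fun_prop
  have hm : Measurable fun p : EuclideanSpace ℝ (Fin n) × EuclideanSpace ℝ (Fin n) =>
      f (AffineMap.homothety p.1 (1 / 2 : ℝ) p.2) := hf.comp hcont.measurable
  have hsymm : ∀ z w : EuclideanSpace ℝ (Fin n),
      AffineMap.homothety w (1 / 2 : ℝ) z = AffineMap.homothety z (1 / 2 : ℝ) w := fun z w => by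
    simp only [AffineMap.homothety_apply, vsub_eq_sub, vadd_eq_add]
    module
  have hone : ∫⁻ w in ball x s, ∫⁻ z in ball x s,
      ‖f z - f (AffineMap.homothety w (1 / 2 : ℝ) z)‖ₑ ≤ K * volume (ball x s) := by
    rw [← setLIntegral_const]
    exact setLIntegral_mono' measurableSet_ball fun w hw =>
      h.setLIntegral_sub_homothety_half_le hn hw
  have hm1 : Measurable fun p : EuclideanSpace ℝ (Fin n) × EuclideanSpace ℝ (Fin n) =>
      ‖f p.2 - f (AffineMap.homothety p.1 (1 / 2 : ℝ) p.2)‖ₑ :=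
    ((hf.comp measurable_snd).sub hm).enorm
  calc ∫⁻ w in ball x s, ∫⁻ z in ball x s, ‖f z - f w‖ₑ
      ≤ ∫⁻ w in ball x s, ∫⁻ z in ball x s,
          (‖f z - f (AffineMap.homothety w (1 / 2 : ℝ) z)‖ₑ +
            ‖f w - f (AffineMap.homothety z (1 / 2 : ℝ) w)‖ₑ) := by
        refine lintegral_mono fun w => lintegral_mono fun z => ?_
        rw [hsymm z w, ← edist_eq_enorm_sub, ← edist_eq_enorm_sub, ← edist_eq_enorm_sub]
        exact edist_triangle_right _ _ _
    _ = (∫⁻ w in ball x s, ∫⁻ z in ball x s,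
          ‖f z - f (AffineMap.homothety w (1 / 2 : ℝ) z)‖ₑ) +
        ∫⁻ w in ball x s, ∫⁻ z in ball x s,
          ‖f w - f (AffineMap.homothety z (1 / 2 : ℝ) w)‖ₑ := by
        rw [← lintegral_add_left hm1.lintegral_prod_right']
        exact lintegral_congr fun w => lintegral_add_left (hm1.comp measurable_prodMk_left) _
    _ ≤ K * volume (ball x s) + K * volume (ball x s) := by
        refine add_le_add hone ?_
        exact (lintegral_lintegral_swap (f := fun w z =>
          ‖f w - f (AffineMap.homothety z (1 / 2 : ℝ) w)‖ₑ)
          (hm1.comp measurable_swap).aemeasurable).trans_le hone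
    _ = _ := (two_mul _).symm

/-- The mean oscillation of `f` over the ball `B(x,s)` is `O(s)` if the maximal function of the
gradient is finite at `x`. -/
theorem HasWeakGradient.setLIntegral_sub_average_le (hn : 1 ≤ n)
    (h : HasWeakGradient f g) (hf : Measurable f) (x : EuclideanSpace ℝ (Fin n)) {s : ℝ}
    (hs : 0 < s) :
    (volume (ball x s))⁻¹ * ∫⁻ z in ball x s, ‖f z - ⨍ w in ball x s, f w‖ₑ ≤
      2 * (ENNReal.ofReal (2 * s) * (ENNReal.ofReal (2 ^ n) *
        centredMaximal (fun y => ‖g y‖) x)) := by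
  have h0 : volume (ball x s) ≠ 0 := (measure_ball_pos volume x hs).ne'
  have ht : volume (ball x s) ≠ ⊤ := measure_ball_lt_top.ne
  have hi : IntegrableOn f (ball x s) := LocallyIntegrable.integrableOn_ball h.1 x s
  have hpt : ∀ z, ‖f z - ⨍ w in ball x s, f w‖ₑ ≤
      (volume (ball x s))⁻¹ * ∫⁻ w in ball x s, ‖f z - f w‖ₑ := fun z => by
    have : f z - ⨍ w in ball x s, f w = ⨍ w in ball x s, (f z - f w) := by
      rw [setAverage_eq _ (fun w => f z - f w), integral_sub (integrable_const_iff.2 (Or.inr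
        ⟨by simpa using ht.lt_top⟩)) hi, smul_sub, ← setAverage_eq, ← setAverage_eq,
        setAverage_const h0 ht]
    rw [this]
    exact enorm_setAverage_le _ _ _
  calc (volume (ball x s))⁻¹ * ∫⁻ z in ball x s, ‖f z - ⨍ w in ball x s, f w‖ₑ
      ≤ (volume (ball x s))⁻¹ * ∫⁻ z in ball x s,
          (volume (ball x s))⁻¹ * ∫⁻ w in ball x s, ‖f z - f w‖ₑ := by
        gcongr
        exact hpt _
    _ = (volume (ball x s))⁻¹ * ((volume (ball x s))⁻¹ *
          ∫⁻ z in ball x s, ∫⁻ w in ball x s, ‖f w - f z‖ₑ) := by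
        rw [lintegral_const_mul' _ _ (ENNReal.inv_ne_top.2 h0)]
        simp_rw [enorm_sub_rev]
    _ ≤ (volume (ball x s))⁻¹ * ((volume (ball x s))⁻¹ * (2 * (ENNReal.ofReal (2 * s) *
          (ENNReal.ofReal (2 ^ n) * (centredMaximal (fun y => ‖g y‖) x * volume (ball x s))) *
            volume (ball x s)))) := by
        gcongr
        exact h.setLIntegral_setLIntegral_sub_le hn hf x s
    _ = ((volume (ball x s))⁻¹ * volume (ball x s)) * ((volume (ball x s))⁻¹ * volume (ball x s)) *
          (2 * (ENNReal.ofReal (2 * s) * (ENNReal.ofReal (2 ^ n) *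
            centredMaximal (fun y => ‖g y‖) x))) := by ring
    _ = _ := by rw [ENNReal.inv_mul_cancel h0 ht, one_mul, one_mul]

theorem HasWeakGradient.enorm_average_sub_average_le (hn : 1 ≤ n)
    (h : HasWeakGradient f g) (x : EuclideanSpace ℝ (Fin n)) {r δ : ℝ} (hr : 0 < r)
    (hδ₀ : 0 < δ) (hδ : δ ≤ 1) :
    ‖(⨍ z in ball x r, f z) - ⨍ z in ball x (δ * r), f z‖ₑ ≤
      ENNReal.ofReal r * centredMaximal (fun y => ‖g y‖) x := by
  have h0 : volume (ball x r) ≠ 0 := (measure_ball_pos volume x hr).ne'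
  have ht : volume (ball x r) ≠ ⊤ := measure_ball_lt_top.ne
  have hi : IntegrableOn f (ball x r) := LocallyIntegrable.integrableOn_ball h.1 x r
  have hi' : IntegrableOn (fun z => f (AffineMap.homothety x δ z)) (ball x r) := by
    have := (LocallyIntegrable.integrableOn_ball h.1 x (δ * r)).smul_measure
      (c := ENNReal.ofReal |(δ ^ Module.finrank ℝ (EuclideanSpace ℝ (Fin n)))⁻¹|)
      ENNReal.ofReal_ne_top
    rw [← AffineMap.homothety_image_ball x hδ₀, ← Measure.map_restrict_homothety volume x hδ₀.ne',
      (AffineMap.measurableEmbedding_homothety x hδ₀.ne').integrable_map_iff] at this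
    exact this
  have heq : (⨍ z in ball x r, f z) - ⨍ z in ball x (δ * r), f z =
      ⨍ z in ball x r, (f z - f (AffineMap.homothety x δ z)) := by
    rw [← AffineMap.homothety_image_ball x hδ₀, ← setAverage_comp_homothety volume x hδ₀.ne',
      setAverage_eq, setAverage_eq, setAverage_eq, integral_sub hi hi', smul_sub]
  rw [heq]
  calc _ ≤ (volume (ball x r))⁻¹ * ∫⁻ z in ball x r, ‖f z - f (AffineMap.homothety x δ z)‖ₑ :=
        enorm_setAverage_le _ _ _
    _ ≤ (volume (ball x r))⁻¹ * ∫⁻ z in ball x r, ENNReal.ofReal r *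
          (‖f z - f (AffineMap.homothety x δ z)‖ₑ / ‖z - x‖ₑ) := by
        refine mul_le_mul_right (setLIntegral_mono' measurableSet_ball fun z hz => ?_) _
        -- At the centre of the homothety both sides vanish, because `0 / 0 = 0`.
        rcases eq_or_ne z x with rfl | hne
        · simp
        · have hz0 : ‖z - x‖ₑ ≠ 0 := enorm_ne_zero.2 (sub_ne_zero.2 hne)
          calc _ = ‖z - x‖ₑ * (‖f z - f (AffineMap.homothety x δ z)‖ₑ / ‖z - x‖ₑ) :=
                (ENNReal.mul_div_cancel hz0 enorm_ne_top).symm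
            _ ≤ _ := by
                gcongr
                rw [← ofReal_norm]
                exact ENNReal.ofReal_le_ofReal (mem_ball_iff_norm.1 hz).le
    _ ≤ (volume (ball x r))⁻¹ * (ENNReal.ofReal r *
          (centredMaximal (fun y => ‖g y‖) x * volume (ball x r))) := by
        rw [lintegral_const_mul' _ _ ENNReal.ofReal_ne_top]
        gcongr
        exact h.setLIntegral_sub_homothety_center_le hn x hr hδ₀ hδ
    _ = ((volume (ball x r))⁻¹ * volume (ball x r)) *
          (ENNReal.ofReal r * centredMaximal (fun y => ‖g y‖) x) := by ring
    _ = _ := by rw [ENNReal.inv_mul_cancel h0 ht, one_mul]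

/-- The averages converge at every point, and not only almost every point, at which the maximal
function of the gradient is finite. -/
theorem HasWeakGradient.exists_averagesTendTo (hn : 1 ≤ n)
    (h : HasWeakGradient f g) {x : EuclideanSpace ℝ (Fin n)}
    (hx : centredMaximal (fun y => ‖g y‖) x ≠ ⊤) : ∃ c, AveragesTendTo f x c := by
  set M := (centredMaximal (fun y => ‖g y‖) x).toReal with hM
  have hM0 : 0 ≤ M := ENNReal.toReal_nonneg
  have hle : ∀ r s : ℝ, 0 < s → s ≤ r →
      dist (⨍ z in ball x r, f z) (⨍ z in ball x s, f z) ≤ r * M := fun r s hs hsr => by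
    have hr : 0 < r := hs.trans_le hsr
    have := h.enorm_average_sub_average_le hn x hr (div_pos hs hr) ((div_le_one hr).2 hsr)
    rw [div_mul_cancel₀ _ hr.ne', ← ofReal_norm, ← ENNReal.ofReal_toReal hx, ← hM,
      ← ENNReal.ofReal_mul hr.le, ENNReal.ofReal_le_ofReal_iff (by positivity)] at this
    rwa [dist_eq_norm]
  have hc : Cauchy (map (fun r : ℝ => ⨍ z in ball x r, f z) (𝓝[>] 0)) := by
    refine Metric.cauchy_iff.2 ⟨inferInstance, fun ε hε => ?_⟩
    have hρ : 0 < ε / (M + 1) := by positivity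
    refine ⟨_, image_mem_map (Ioo_mem_nhdsGT hρ), ?_⟩
    have hlt : ∀ r : ℝ, 0 < r → r < ε / (M + 1) → r * M < ε := fun r hr hrρ => by
      rw [lt_div_iff₀ (by positivity)] at hrρ
      linarith
    rintro _ ⟨r, hr, rfl⟩ _ ⟨s, hs, rfl⟩
    rcases le_total s r with hsr | hrs
    · exact (hle r s hs.1 hsr).trans_lt (hlt r hr.1 hr.2)
    · rw [dist_comm]
      exact (hle s r hr.1 hrs).trans_lt (hlt s hs.1 hs.2)
  exact cauchy_iff_exists_le_nhds.1 hc

theorem HasWeakGradient.tendsto_average_enorm_sub (hn : 1 ≤ n)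
    (h : HasWeakGradient f g) (hf : Measurable f) {x : EuclideanSpace ℝ (Fin n)}
    (hx : centredMaximal (fun y => ‖g y‖) x ≠ ⊤) {c : ℝ} (hc : AveragesTendTo f x c) :
    Tendsto (fun s : ℝ => (volume (ball x s))⁻¹ * ∫⁻ z in ball x s, ‖f z - c‖ₑ)
      (𝓝[>] 0) (𝓝 0) := by
  have hlim : Tendsto (fun s : ℝ => 2 * (ENNReal.ofReal (2 * s) * (ENNReal.ofReal (2 ^ n) *
      centredMaximal (fun y => ‖g y‖) x)) + ‖(⨍ w in ball x s, f w) - c‖ₑ) (𝓝[>] 0) (𝓝 0) := by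
    have hc' : Tendsto (fun s : ℝ => ⨍ w in ball x s, f w) (𝓝[>] 0) (𝓝 c) := hc
    have hK : ENNReal.ofReal (2 ^ n) * centredMaximal (fun y => ‖g y‖) x ≠ ⊤ :=
      ENNReal.mul_ne_top ENNReal.ofReal_ne_top hx
    generalize ENNReal.ofReal (2 ^ n) * centredMaximal (fun y => ‖g y‖) x = K at hK ⊢
    have h1 : Tendsto (fun s : ℝ => ENNReal.ofReal (2 * s)) (𝓝[>] 0) (𝓝 0) := by
      have : Continuous fun s : ℝ => ENNReal.ofReal (2 * s) :=
        ENNReal.continuous_ofReal.comp (continuous_const.mul continuous_id)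
      simpa using (this.tendsto 0).mono_left nhdsWithin_le_nhds
    have h2 : Tendsto (fun s : ℝ => 2 * (ENNReal.ofReal (2 * s) * K)) (𝓝[>] 0) (𝓝 0) := by
      have := ENNReal.Tendsto.const_mul (a := 2) (ENNReal.Tendsto.mul_const h1 (Or.inr hK))
        (Or.inr ENNReal.ofNat_ne_top)
      rwa [zero_mul, mul_zero] at this
    have h3 : Tendsto (fun s : ℝ => ‖(⨍ w in ball x s, f w) - c‖ₑ) (𝓝[>] 0) (𝓝 0) := by
      have := (hc'.sub_const c).enorm
      rwa [sub_self, enorm_zero] at this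
    have := h2.add h3
    rwa [add_zero] at this
  refine tendsto_of_tendsto_of_tendsto_of_le_of_le' tendsto_const_nhds hlim
    (Eventually.of_forall fun _ => zero_le) ?_
  filter_upwards [self_mem_nhdsWithin] with s hs
  have h0 : volume (ball x s) ≠ 0 := (measure_ball_pos volume x hs).ne'
  have ht : volume (ball x s) ≠ ⊤ := measure_ball_lt_top.ne
  calc _ ≤ (volume (ball x s))⁻¹ * ∫⁻ z in ball x s,
          (‖f z - ⨍ w in ball x s, f w‖ₑ + ‖(⨍ w in ball x s, f w) - c‖ₑ) := by
        gcongr with z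
        simp only [← edist_eq_enorm_sub]
        exact edist_triangle _ _ _
    _ = (volume (ball x s))⁻¹ * (∫⁻ z in ball x s, ‖f z - ⨍ w in ball x s, f w‖ₑ) +
          ‖(⨍ w in ball x s, f w) - c‖ₑ := by
        rw [lintegral_add_right _ measurable_const, setLIntegral_const, mul_add,
          mul_comm _ (volume _), ← mul_assoc _ (volume _), ENNReal.inv_mul_cancel h0 ht, one_mul]
    _ ≤ _ := by
        exact add_le_add_left (h.setLIntegral_sub_average_le hn hf x hs) _

/-- The dilations `z ↦ f (x + δ (z - x))` converge to `c` in `L¹` of the ball as `δ → 0`, hence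
almost everywhere along a sequence, and Fatou's lemma applies once more. -/
theorem HasWeakGradient.setLIntegral_sub_div_le_of_measurable (hn : 1 ≤ n)
    (h : HasWeakGradient f g) (hf : Measurable f) {x : EuclideanSpace ℝ (Fin n)}
    (hx : centredMaximal (fun y => ‖g y‖) x ≠ ⊤) {c : ℝ} (hc : AveragesTendTo f x c)
    {r : ℝ} (hr : 0 < r) :
    ∫⁻ z in ball x r, ‖f z - c‖ₑ / ‖z - x‖ₑ ≤
      centredMaximal (fun y => ‖g y‖) x * volume (ball x r) := by
  have : Nonempty (Fin n) := ⟨⟨0, hn⟩⟩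
  have ht : volume (ball x r) ≠ ⊤ := measure_ball_lt_top.ne
  let δ : ℕ → ℝ := fun k => 1 / ((k : ℝ) + 1)
  have hδ₀ : ∀ k, 0 < δ k := fun k => by positivity
  have hδ₁ : ∀ k, δ k ≤ 1 := fun k => by
    simp only [δ]
    rw [div_le_one (by positivity)]
    linarith [(Nat.cast_nonneg k : (0 : ℝ) ≤ k)]
  let v : ℕ → EuclideanSpace ℝ (Fin n) → ℝ := fun k z => f (AffineMap.homothety x (δ k) z)
  have hv : ∀ k, Measurable (v k) := fun k =>
    hf.comp (AffineMap.homothety_continuous x (δ k)).measurable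
  have hL1 : ∀ k, ∫⁻ z in ball x r, ‖v k z - c‖ₑ = volume (ball x r) *
      ((volume (ball x (δ k * r)))⁻¹ * ∫⁻ z in ball x (δ k * r), ‖f z - c‖ₑ) := fun k => by
    have hp : 0 < δ k ^ Module.finrank ℝ (EuclideanSpace ℝ (Fin n)) := pow_pos (hδ₀ k) _
    have hV : volume (ball x (δ k * r)) =
        ENNReal.ofReal (δ k ^ Module.finrank ℝ (EuclideanSpace ℝ (Fin n))) *
          volume (ball x r) := by
      rw [Measure.addHaar_ball_mul_of_pos volume x (hδ₀ k), Measure.addHaar_ball_center volume x r]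
    rw [setLIntegral_comp_homothety volume x (hδ₀ k).ne' (ball x r) (fun z => ‖f z - c‖ₑ),
      AffineMap.homothety_image_ball x (hδ₀ k), ← mul_assoc, hV,
      ENNReal.mul_inv (Or.inr ht) (Or.inl ENNReal.ofReal_ne_top), mul_left_comm,
      ENNReal.mul_inv_cancel (measure_ball_pos volume x hr).ne' ht, mul_one,
      abs_of_pos (inv_pos.2 hp), ENNReal.ofReal_inv_of_pos hp]
  have hvlim : Tendsto (fun k => eLpNorm (v k - fun _ => c) 1 (volume.restrict (ball x r)))
      atTop (𝓝 0) := by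
    simp only [eLpNorm_one_eq_lintegral_enorm, Pi.sub_apply, hL1]
    have hδr : Tendsto (fun k => δ k * r) atTop (𝓝[>] 0) := by
      refine tendsto_nhdsWithin_iff.2 ⟨?_, Eventually.of_forall fun k => mul_pos (hδ₀ k) hr⟩
      simpa [δ] using tendsto_one_div_add_atTop_nhds_zero_nat.mul_const r
    simpa using ENNReal.Tendsto.const_mul ((h.tendsto_average_enorm_sub hn hf hx hc).comp hδr)
      (Or.inr ht)
  obtain ⟨ns, -, hns⟩ := (tendstoInMeasure_of_tendsto_eLpNorm one_ne_zero
    (fun k => (hv k).aestronglyMeasurable) aestronglyMeasurable_const hvlim).exists_seq_tendsto_ae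
  calc ∫⁻ z in ball x r, ‖f z - c‖ₑ / ‖z - x‖ₑ
      = ∫⁻ z in ball x r, liminf (fun k => ‖f z - v (ns k) z‖ₑ / ‖z - x‖ₑ) atTop := by
        refine lintegral_congr_ae ?_
        filter_upwards [hns, ae_restrict_of_ae (compl_mem_ae_iff.2 (measure_singleton x))]
          with z hz hne
        refine (Tendsto.liminf_eq (ENNReal.Tendsto.div_const
          (tendsto_const_nhds.sub hz).enorm (Or.inr ?_))).symm
        exact enorm_ne_zero.2 (sub_ne_zero.2 hne)
    _ ≤ liminf (fun k => ∫⁻ z in ball x r, ‖f z - v (ns k) z‖ₑ / ‖z - x‖ₑ) atTop := by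
        refine lintegral_liminf_le' fun k => (Measurable.div ?_ ?_).aemeasurable
        · exact (hf.sub (hv _)).enorm
        · exact (measurable_id.sub_const x).enorm
    _ ≤ liminf (fun _ : ℕ => centredMaximal (fun y => ‖g y‖) x * volume (ball x r)) atTop :=
        liminf_le_liminf (Eventually.of_forall fun k =>
          h.setLIntegral_sub_homothety_center_le hn x hr (hδ₀ _) (hδ₁ _))
    _ = _ := liminf_const _

/-! ### The pointwise bound for `MQ` -/

theorem AveragesTendTo.congr_ae {f' : EuclideanSpace ℝ (Fin n) → ℝ} (hff' : f =ᵐ[volume] f')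
    {x : EuclideanSpace ℝ (Fin n)} {c : ℝ} (hc : AveragesTendTo f x c) :
    AveragesTendTo f' x c := by
  refine Tendsto.congr (fun r => ?_) hc
  rw [setAverage_eq, setAverage_eq, integral_congr_ae (ae_restrict_of_ae hff')]

theorem HasWeakGradient.congr_ae {f' : EuclideanSpace ℝ (Fin n) → ℝ} (hff' : f =ᵐ[volume] f')
    (h : HasWeakGradient f g) : HasWeakGradient f' g := by
  refine ⟨h.1.congr hff', h.2.1, fun φ hφ hφs => ?_⟩
  rw [← h.2.2 φ hφ hφs]
  refine integral_congr_ae ?_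
  filter_upwards [hff'] with x hx
  rw [hx]

/-- If the averages of `f` at `x` converge to `c`, then the averaged difference quotients of `f`
with `c` in place of `f x` are bounded by the maximal function of the gradient. -/
theorem HasWeakGradient.average_sub_div_le_centredMaximal (hn : 1 ≤ n)
    (h : HasWeakGradient f g) {x : EuclideanSpace ℝ (Fin n)} {c : ℝ} (hc : AveragesTendTo f x c)
    {r : ℝ} (hr : 0 < r) :
    (volume (ball x r))⁻¹ * ∫⁻ z in ball x r, ‖f z - c‖ₑ / ‖z - x‖ₑ ≤
      centredMaximal (fun y => ‖g y‖) x := by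
  rcases eq_or_ne (centredMaximal (fun y => ‖g y‖) x) ⊤ with hx | hx
  · simp [hx]
  have h0 : volume (ball x r) ≠ 0 := (measure_ball_pos volume x hr).ne'
  have ht : volume (ball x r) ≠ ⊤ := measure_ball_lt_top.ne
  have hm := h.1.aestronglyMeasurable.aemeasurable
  have := (h.congr_ae hm.ae_eq_mk).setLIntegral_sub_div_le_of_measurable hn hm.measurable_mk hx
    (hc.congr_ae hm.ae_eq_mk) hr
  calc _ = (volume (ball x r))⁻¹ * ∫⁻ z in ball x r, ‖hm.mk f z - c‖ₑ / ‖z - x‖ₑ := by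
        congr 1
        refine lintegral_congr_ae (ae_restrict_of_ae ?_)
        filter_upwards [hm.ae_eq_mk] with z hz
        rw [hz]
    _ ≤ (volume (ball x r))⁻¹ * (centredMaximal (fun y => ‖g y‖) x * volume (ball x r)) := by
        gcongr
    _ = _ := by rw [mul_left_comm, ENNReal.inv_mul_cancel h0 ht, mul_one]

theorem MQ_le_of_ae_eq (hn : 1 ≤ n) (h : HasWeakGradient f g)
    {F : EuclideanSpace ℝ (Fin n) → ℝ} (hF : F =ᵐ[volume] f)
    {x : EuclideanSpace ℝ (Fin n)} (hx : AveragesTendTo f x (F x)) :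
    MQ F x ≤ centredMaximal (fun y => ‖g y‖) x := by
  refine iSup₂_le fun r hr => ?_
  refine le_trans (le_of_eq ?_) (h.average_sub_div_le_centredMaximal hn hx hr)
  unfold meanQuotient
  congr 1
  refine lintegral_congr_ae (ae_restrict_of_ae ?_)
  filter_upwards [hF] with z hz
  rw [hz]

theorem ae_averagesTendTo (hn : 1 ≤ n) (hf : LocallyIntegrable f) :
    ∀ᵐ x, AveragesTendTo f x (f x) := by
  have : Nonempty (Fin n) := ⟨⟨0, hn⟩⟩
  filter_upwards [IsUnifLocDoublingMeasure.ae_tendsto_average volume hf 1] with x hx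
  refine (hx (fun _ => x) id tendsto_id ?_).congr fun r => ?_
  · filter_upwards [self_mem_nhdsWithin] with r hr
    exact mem_closedBall_self (by simpa using (le_of_lt hr))
  · exact setAverage_congr (ae_eq_of_subset_of_measure_ge ball_subset_closedBall
      (Measure.addHaar_closedBall_eq_addHaar_ball volume x r).le
      measurableSet_ball.nullMeasurableSet measure_closedBall_lt_top.ne).symm

theorem AveragesTendTo.preciseRep_eq {x : EuclideanSpace ℝ (Fin n)} {c : ℝ}
    (hc : AveragesTendTo f x c) : preciseRep f x = c := by
  have hex : ∃ c, AveragesTendTo f x c := ⟨c, hc⟩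
  rw [preciseRep, dif_pos hex]
  exact tendsto_nhds_unique hex.choose_spec hc

theorem preciseRep_ae_eq (hn : 1 ≤ n) (hf : LocallyIntegrable f) :
    preciseRep f =ᵐ[volume] f := by
  filter_upwards [ae_averagesTendTo hn hf] with x hx using hx.preciseRep_eq

theorem MQ_preciseRep_le (hn : 1 ≤ n) (h : HasWeakGradient f g) (x : EuclideanSpace ℝ (Fin n)) :
    MQ (preciseRep f) x ≤ centredMaximal (fun y => ‖g y‖) x := by
  rcases eq_or_ne (centredMaximal (fun y => ‖g y‖) x) ⊤ with hx | hx
  · simp [hx]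
  obtain ⟨c, hc⟩ := h.exists_averagesTendTo hn hx
  exact MQ_le_of_ae_eq hn h (preciseRep_ae_eq hn h.1) (by rwa [hc.preciseRep_eq])

end WeakGradient

/-! ### The Hardy–Littlewood maximal theorem -/

section MaximalTheorem

variable {E : Type*} [NormedAddCommGroup E] [NormedSpace ℝ E] [FiniteDimensional ℝ E]
  [MeasurableSpace E] [BorelSpace E] (μ : Measure E) [μ.IsAddHaarMeasure]

/-- The centred Hardy–Littlewood maximal function of a function with values in `[0,∞]`, with respect
to the measure `μ`. -/
noncomputable def maximalLIntegral (h : E → ℝ≥0∞) (x : E) : ℝ≥0∞ :=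
  ⨆ (r : ℝ) (_ : 0 < r), (μ (ball x r))⁻¹ * ∫⁻ y in ball x r, h y ∂μ

/-- The Vitali covering argument, for balls of bounded radii. -/
theorem mul_measure_le_of_forall_ball [Nontrivial E] (h : E → ℝ≥0∞) (t : ℝ≥0∞) (R : ℝ) (A : Set E)
    (hA : ∀ x ∈ A, ∃ r : ℝ, 0 < r ∧ r ≤ R ∧ t * μ (ball x r) ≤ ∫⁻ y in ball x r, h y ∂μ) :
    t * μ A ≤ ENNReal.ofReal (5 ^ Module.finrank ℝ E) * ∫⁻ y, h y ∂μ := by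
  choose! r hr₀ hrR hr using hA
  obtain ⟨u, huA, hdisj, hcov⟩ := Vitali.exists_disjoint_subfamily_covering_enlargement_closedBall
    A id r R hrR 5 (by norm_num)
  simp only [id] at hdisj hcov
  have hu : u.Countable := hdisj.countable_of_nonempty_interior fun b hb =>
    (nonempty_ball.2 (hr₀ b (huA hb))).mono ball_subset_interior_closedBall
  have hdisj' : u.PairwiseDisjoint fun b => ball b (r b) :=
    hdisj.mono fun b => ball_subset_closedBall
  have hsub : A ⊆ ⋃ b ∈ u, closedBall b (5 * r b) := fun x hx => by
    obtain ⟨b, hb, hxb⟩ := hcov x hx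
    exact Set.mem_biUnion hb (hxb (mem_closedBall_self (hr₀ x hx).le))
  have : Countable u := hu.to_subtype
  calc t * μ A ≤ t * ∑' b : u, μ (closedBall (b : E) (5 * r b)) := by
        gcongr
        exact (measure_mono hsub).trans (measure_biUnion_le μ hu _)
    _ = ∑' b : u, ENNReal.ofReal (5 ^ Module.finrank ℝ E) * (t * μ (ball (b : E) (r b))) := by
        rw [← ENNReal.tsum_mul_left]
        refine tsum_congr fun b => ?_
        rw [Measure.addHaar_closedBall_eq_addHaar_ball,
          Measure.addHaar_ball_mul_of_pos μ _ (by norm_num), Measure.addHaar_ball_center μ (b : E),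
          mul_left_comm]
    _ ≤ ∑' b : u, ENNReal.ofReal (5 ^ Module.finrank ℝ E) * ∫⁻ y in ball (b : E) (r b), h y ∂μ := by
        gcongr with b
        exact hr b (huA b.2)
    _ = ENNReal.ofReal (5 ^ Module.finrank ℝ E) * ∫⁻ y in ⋃ b ∈ u, ball b (r b), h y ∂μ := by
        rw [ENNReal.tsum_mul_left,
          lintegral_biUnion hu (fun _ _ => measurableSet_ball) hdisj']
    _ ≤ _ := by
        exact mul_le_mul_right (setLIntegral_le_lintegral _ _) _

/-- The weak type `(1,1)` inequality. The bound on the radii needed for the covering argument is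
removed by exhaustion. -/
theorem mul_measure_lt_maximalLIntegral_le [Nontrivial E] (h : E → ℝ≥0∞) (t : ℝ≥0∞) :
    t * μ {x | t < maximalLIntegral μ h x} ≤
      ENNReal.ofReal (5 ^ Module.finrank ℝ E) * ∫⁻ y, h y ∂μ := by
  let A : ℕ → Set E := fun N =>
    {x | ∃ r : ℝ, 0 < r ∧ r ≤ N ∧ t * μ (ball x r) ≤ ∫⁻ y in ball x r, h y ∂μ}
  have hA : Monotone A := fun N N' hN x ⟨r, hr₀, hrN, hr⟩ =>
    ⟨r, hr₀, hrN.trans (Nat.cast_le.2 hN), hr⟩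
  -- The sets `A N` need not be measurable: continuity from below holds for the outer measure.
  have hsub : {x | t < maximalLIntegral μ h x} ⊆ ⋃ N, A N := fun x hx => by
    simp only [Set.mem_ofPred_eq, maximalLIntegral, lt_iSup_iff] at hx
    obtain ⟨r, hr₀, hr⟩ := hx
    obtain ⟨N, hN⟩ := exists_nat_ge r
    refine Set.mem_iUnion.2 ⟨N, r, hr₀, hN, ?_⟩
    rw [mul_comm, ← div_eq_mul_inv] at hr
    exact ENNReal.mul_le_of_le_div hr.le
  calc t * μ {x | t < maximalLIntegral μ h x} ≤ t * ⨆ N, μ (A N) := by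
        gcongr
        rw [← hA.measure_iUnion]
        exact measure_mono hsub
    _ ≤ _ := by
        rw [ENNReal.mul_iSup]
        exact iSup_le fun N => mul_measure_le_of_forall_ball μ h t N (A N) fun x hx => hx

/-- The weak type inequality for the part of `h` above height `t`: the part of `h` below `t`
contributes at most `t` to the maximal function. -/
theorem mul_measure_two_mul_lt_maximalLIntegral_le [Nontrivial E] {h : E → ℝ≥0∞}
    (hh : Measurable h) {t : ℝ≥0∞} (ht : t ≠ ⊤) :
    t * μ {x | 2 * t < maximalLIntegral μ h x} ≤
      ENNReal.ofReal (5 ^ Module.finrank ℝ E) * ∫⁻ y in {y | t < h y}, h y ∂μ := by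
  have hS : MeasurableSet {y | t < h y} := measurableSet_lt measurable_const hh
  rw [← lintegral_indicator hS]
  refine le_trans ?_ (mul_measure_lt_maximalLIntegral_le μ _ t)
  gcongr t * μ ?_
  intro x hx
  have hle : maximalLIntegral μ h x ≤
      maximalLIntegral μ ({y | t < h y}.indicator h) x + t := by
    refine iSup₂_le fun r hr => ?_
    calc (μ (ball x r))⁻¹ * ∫⁻ y in ball x r, h y ∂μ
        ≤ (μ (ball x r))⁻¹ * ∫⁻ y in ball x r, ({y | t < h y}.indicator h y + t) ∂μ := by
          gcongr with y
          by_cases hy : t < h y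
          · rw [Set.indicator_of_mem (by exact hy)]
            exact le_self_add
          · rw [Set.indicator_of_notMem (by exact hy), zero_add]
            exact not_lt.1 hy
      _ = (μ (ball x r))⁻¹ * (∫⁻ y in ball x r, {y | t < h y}.indicator h y ∂μ) + t := by
          rw [lintegral_add_right _ measurable_const, setLIntegral_const, mul_add, mul_left_comm,
            ENNReal.inv_mul_cancel (measure_ball_pos μ x hr).ne' measure_ball_lt_top.ne, mul_one]
      _ ≤ _ := by
          gcongr
          exact le_iSup₂ (f := fun (r : ℝ) (_ : 0 < r) =>
            (μ (ball x r))⁻¹ * ∫⁻ y in ball x r, {y | t < h y}.indicator h y ∂μ) r hr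
  simp only [Set.mem_ofPred_eq, two_mul] at hx ⊢
  exact (ENNReal.add_lt_add_iff_right ht).1 (hx.trans_le hle)

end MaximalTheorem

/-- Marcinkiewicz interpolation between `L^∞` and weak `L¹`, on the level of distribution
functions. The layer cake formula is used twice: for `F`, and backwards for `k` with respect to the
measure with density `k`. -/
theorem lintegral_rpow_lt_top_of_distribution_le {α : Type*} [MeasurableSpace α] {μ : Measure α}
    {F : α → ℝ≥0∞} (hF : AEMeasurable F μ) {k : α → ℝ} (hk : Measurable k) (hk₀ : ∀ x, 0 ≤ k x)
    {C : ℝ≥0∞} (hC : C ≠ ⊤)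
    (hFk : ∀ t : ℝ, 0 < t → ENNReal.ofReal t * μ {x | 2 * ENNReal.ofReal t < F x} ≤
      C * ∫⁻ x in {x | ENNReal.ofReal t < ENNReal.ofReal (k x)}, ENNReal.ofReal (k x) ∂μ)
    {p : ℝ} (hp : 1 < p) (hkp : ∫⁻ x, ENNReal.ofReal (k x) ^ p ∂μ < ⊤) :
    ∫⁻ x, F x ^ p ∂μ < ⊤ := by
  have hp₀ : 0 < p := one_pos.trans hp
  set ν := μ.withDensity fun x => ENNReal.ofReal (k x) with hν
  set J := ∫⁻ t in Set.Ioi (0 : ℝ), ν {x | t < 2 * k x} * ENNReal.ofReal (t ^ (p - 1 - 1)) with hJ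
  have hJtop : J ≠ ⊤ := by
    have hlayer := lintegral_rpow_eq_lintegral_meas_lt_mul ν (f := fun x => 2 * k x)
      (Eventually.of_forall fun x => mul_nonneg two_pos.le (hk₀ x)) (hk.const_mul 2).aemeasurable
      (sub_pos.2 hp)
    rw [← hJ, lintegral_withDensity_eq_lintegral_mul _ hk.ennreal_ofReal
      (((hk.const_mul 2).pow_const _).ennreal_ofReal)] at hlayer
    have hpt : ∀ x, ENNReal.ofReal (k x) * ENNReal.ofReal ((2 * k x) ^ (p - 1)) =
        ENNReal.ofReal (2 ^ (p - 1)) * ENNReal.ofReal (k x) ^ p := fun x => by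
      rw [Real.mul_rpow two_pos.le (hk₀ x), ENNReal.ofReal_mul (by positivity), mul_left_comm,
        ENNReal.ofReal_rpow_of_nonneg (hk₀ x) hp₀.le, ← ENNReal.ofReal_mul (hk₀ x),
        ← Real.rpow_one_add' (hk₀ x) (by linarith), add_sub_cancel]
    simp only [Pi.mul_apply, hpt] at hlayer
    rw [lintegral_const_mul' _ _ ENNReal.ofReal_ne_top] at hlayer
    intro htop
    rw [htop, ENNReal.mul_top (by simpa using hp)] at hlayer
    exact (ENNReal.mul_lt_top ENNReal.ofReal_lt_top hkp).ne hlayer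
  -- Truncation makes `F` finite, as required by the layer cake formula for real functions.
  have hbound : ∀ N : ℕ, ∫⁻ x, (min (F x) N) ^ p ∂μ ≤ ENNReal.ofReal p * (C * 2 * J) := fun N => by
    have hfin : ∀ x, min (F x) N ≠ ⊤ := fun x =>
      ((min_le_right _ _).trans_lt (ENNReal.natCast_lt_top N)).ne
    have hlayer := lintegral_rpow_eq_lintegral_meas_lt_mul μ (f := fun x => (min (F x) N).toReal)
      (Eventually.of_forall fun x => ENNReal.toReal_nonneg)
      (hF.min aemeasurable_const).ennreal_toReal hp₀
    calc ∫⁻ x, (min (F x) N) ^ p ∂μ = ∫⁻ x, ENNReal.ofReal ((min (F x) N).toReal ^ p) ∂μ := by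
          refine lintegral_congr fun x => ?_
          rw [← ENNReal.ofReal_rpow_of_nonneg ENNReal.toReal_nonneg hp₀.le,
            ENNReal.ofReal_toReal (hfin x)]
      _ ≤ ENNReal.ofReal p * ∫⁻ t in Set.Ioi (0 : ℝ),
            C * 2 * (ν {x | t < 2 * k x} * ENNReal.ofReal (t ^ (p - 1 - 1))) := by
          rw [hlayer]
          refine mul_le_mul_right (setLIntegral_mono' measurableSet_Ioi fun t (ht : 0 < t) => ?_) _
          have hset : {x | ENNReal.ofReal (t / 2) < ENNReal.ofReal (k x)} = {x | t < 2 * k x} := by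
            ext x
            rw [Set.mem_ofPred_eq, Set.mem_ofPred_eq, ENNReal.ofReal_lt_ofReal_iff_of_nonneg
              (by positivity), div_lt_iff₀ two_pos, mul_comm]
          have hsub : {x | t < (min (F x) N).toReal} ⊆ {x | 2 * ENNReal.ofReal (t / 2) < F x} := by
            intro x hx
            have h2 : 2 * ENNReal.ofReal (t / 2) = ENNReal.ofReal t := by
              rw [← ENNReal.ofReal_ofNat 2, ← ENNReal.ofReal_mul two_pos.le]
              congr 1
              ring
            rw [Set.mem_ofPred_eq, h2]
            exact ((ENNReal.ofReal_lt_iff_lt_toReal ht.le (hfin x)).2 hx).trans_le (min_le_left _ _)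
          have hm : MeasurableSet {x | t < 2 * k x} :=
            measurableSet_lt measurable_const (hk.const_mul 2)
          have hpow : ENNReal.ofReal (t ^ (p - 1)) =
              ENNReal.ofReal (t / 2) * (2 * ENNReal.ofReal (t ^ (p - 1 - 1))) := by
            rw [← ENNReal.ofReal_ofNat 2, ← ENNReal.ofReal_mul two_pos.le,
              ← ENNReal.ofReal_mul (by positivity), Real.rpow_sub_one ht.ne' (p - 1)]
            congr 1
            field_simp
          calc _ ≤ μ {x | 2 * ENNReal.ofReal (t / 2) < F x} * ENNReal.ofReal (t ^ (p - 1)) := by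
                gcongr
            _ = (ENNReal.ofReal (t / 2) * μ {x | 2 * ENNReal.ofReal (t / 2) < F x}) *
                  (2 * ENNReal.ofReal (t ^ (p - 1 - 1))) := by
                rw [hpow]
                ring
            _ ≤ (C * ν {x | t < 2 * k x}) * (2 * ENNReal.ofReal (t ^ (p - 1 - 1))) := by
                refine mul_le_mul_left ?_ _
                have := hFk (t / 2) (by positivity)
                rwa [hset, ← withDensity_apply _ hm] at this
            _ = _ := by ring
      _ = _ := by
          rw [lintegral_const_mul' _ _ (ENNReal.mul_ne_top hC ENNReal.ofNat_ne_top)]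
  refine lt_of_le_of_lt (le_of_tendsto' (lintegral_tendsto_of_tendsto_of_monotone
    (f := fun (N : ℕ) x => (min (F x) N) ^ p) (fun N => (hF.min aemeasurable_const).pow_const p)
    (Eventually.of_forall fun x N N' hN => ?_) (Eventually.of_forall fun x => ?_)) hbound) ?_
  · exact ENNReal.rpow_le_rpow (min_le_min_left _ (Nat.cast_le.2 hN)) hp₀.le
  · refine (ENNReal.continuous_rpow_const.tendsto (F x)).comp ?_
    simpa using (tendsto_const_nhds (x := F x)).min ENNReal.tendsto_nat_nhds_top
  · exact ENNReal.mul_lt_top ENNReal.ofReal_lt_top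
      (ENNReal.mul_lt_top (ENNReal.mul_lt_top hC.lt_top ENNReal.ofNat_lt_top) hJtop.lt_top)

section Lp

variable {n : ℕ}

theorem centredMaximal_le_eLpNorm_top {h : EuclideanSpace ℝ (Fin n) → ℝ}
    (x : EuclideanSpace ℝ (Fin n)) : centredMaximal h x ≤ eLpNorm h ⊤ volume := by
  refine iSup₂_le fun r hr => ?_
  calc (volume (ball x r))⁻¹ * ∫⁻ y in ball x r, ‖h y‖ₑ
      ≤ (volume (ball x r))⁻¹ * ∫⁻ y in ball x r, eLpNorm h ⊤ volume := by
        refine mul_le_mul_right (lintegral_mono_ae (ae_restrict_of_ae ?_)) _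
        rw [eLpNorm_exponent_top]
        exact enorm_ae_le_eLpNormEssSup h volume
    _ = eLpNorm h ⊤ volume := by
        rw [setLIntegral_const, mul_left_comm,
          ENNReal.inv_mul_cancel (measure_ball_pos volume x hr).ne' measure_ball_lt_top.ne, mul_one]

/-- The Hardy–Littlewood maximal theorem for `1 < p`, for measurable functions dominated by the
maximal function. -/
theorem memLp_of_ae_le_centredMaximal (hn : 1 ≤ n) {p : ℝ≥0∞} (hp : 1 < p)
    {h : EuclideanSpace ℝ (Fin n) → ℝ} (hh : MemLp h p)
    {F : EuclideanSpace ℝ (Fin n) → ℝ≥0∞} (hF : AEMeasurable F)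
    (hFh : ∀ᵐ x, F x ≤ centredMaximal h x) : MemLp F p := by
  have : Nonempty (Fin n) := ⟨⟨0, hn⟩⟩
  refine ⟨hF.aestronglyMeasurable, ?_⟩
  rcases eq_or_ne p ⊤ with rfl | hp'
  · rw [eLpNorm_exponent_top]
    refine lt_of_le_of_lt (eLpNormEssSup_le_of_ae_enorm_bound ?_) hh.2
    filter_upwards [hFh] with x hx
    exact hx.trans (centredMaximal_le_eLpNorm_top x)
  have hp₀ : p ≠ 0 := (one_pos.trans hp).ne'
  have hp₁ : 1 < p.toReal := by
    rwa [← ENNReal.toReal_one, ENNReal.toReal_lt_toReal ENNReal.one_ne_top hp']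
  have hm := hh.1.aemeasurable
  set k : EuclideanSpace ℝ (Fin n) → ℝ := fun y => ‖hm.mk h y‖ with hk
  have hkm : Measurable k := hm.measurable_mk.norm
  have hkh : ∀ᵐ y, ENNReal.ofReal (k y) = ‖h y‖ₑ := by
    filter_upwards [hm.ae_eq_mk] with y hy
    rw [hk, hy]
    exact ofReal_norm _
  have hmax : centredMaximal h = maximalLIntegral volume fun y => ENNReal.ofReal (k y) := by
    ext x
    unfold centredMaximal maximalLIntegral
    refine iSup_congr fun r => iSup_congr fun _ => ?_
    rw [lintegral_congr_ae (ae_restrict_of_ae hkh)]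
  rw [hmax] at hFh
  refine (eLpNorm_lt_top_iff_lintegral_rpow_enorm_lt_top hp₀ hp').2 ?_
  refine lintegral_rpow_lt_top_of_distribution_le
    (C := ENNReal.ofReal (5 ^ Module.finrank ℝ (EuclideanSpace ℝ (Fin n)))) hF hkm
    (fun _ => norm_nonneg _) ENNReal.ofReal_ne_top (fun t ht => ?_) hp₁ ?_
  · refine le_trans ?_ (mul_measure_two_mul_lt_maximalLIntegral_le volume hkm.ennreal_ofReal
      ENNReal.ofReal_ne_top)
    refine mul_le_mul_right (measure_mono_ae ?_) _
    filter_upwards [hFh] with x hx hlt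
    exact lt_of_lt_of_le hlt hx
  · refine lt_of_le_of_lt (le_of_eq (lintegral_congr_ae ?_))
      ((eLpNorm_lt_top_iff_lintegral_rpow_enorm_lt_top hp₀ hp').1 hh.2)
    filter_upwards [hkh] with y hy
    rw [hy]

/-! ### Measurability of `MQ` -/

theorem measurable_meanQuotient {f : EuclideanSpace ℝ (Fin n) → ℝ} (hf : Measurable f) (r : ℝ) :
    Measurable (meanQuotient f r) := by
  have hF : Measurable fun p : EuclideanSpace ℝ (Fin n) × EuclideanSpace ℝ (Fin n) =>
      ‖f p.2 - f p.1‖ₑ / ‖p.2 - p.1‖ₑ :=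
    ((hf.comp measurable_snd).sub (hf.comp measurable_fst)).enorm.div
      (measurable_snd.sub measurable_fst).enorm
  have hS : MeasurableSet {p : EuclideanSpace ℝ (Fin n) × EuclideanSpace ℝ (Fin n) |
      p.2 ∈ ball p.1 r} :=
    measurableSet_lt (measurable_snd.dist measurable_fst) measurable_const
  have : meanQuotient f r = fun x => (volume (ball (0 : EuclideanSpace ℝ (Fin n)) r))⁻¹ *
      ∫⁻ z, {p : EuclideanSpace ℝ (Fin n) × EuclideanSpace ℝ (Fin n) |
        p.2 ∈ ball p.1 r}.indicator (fun p => ‖f p.2 - f p.1‖ₑ / ‖p.2 - p.1‖ₑ) (x, z) := by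
    ext x
    rw [meanQuotient, Measure.addHaar_ball_center, ← lintegral_indicator measurableSet_ball]
    rfl
  rw [this]
  exact (hF.indicator hS).lintegral_prod_right'.const_mul _

/-- Rational radii suffice in the supremum defining `MQ f x`, because the balls are open: the
integral over `B(x,r)` is the supremum of those over `B(x,q)` with `q < r`, and the normalizing
factor is larger for the smaller balls. -/
theorem MQ_eq_iSup_rat (f : EuclideanSpace ℝ (Fin n) → ℝ) (x : EuclideanSpace ℝ (Fin n)) :
    MQ f x = ⨆ (q : ℚ) (_ : 0 < q), meanQuotient f q x := by
  refine le_antisymm (iSup₂_le fun r hr => ?_) (iSup₂_le fun q hq =>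
    le_iSup₂ (f := fun (r : ℝ) (_ : 0 < r) => meanQuotient f r x) (q : ℝ) (by exact_mod_cast hq))
  have hball : ball x r = ⋃ q : {q : ℚ // 0 < q ∧ (q : ℝ) < r}, ball x (q : ℚ) := by
    ext z
    simp only [Set.mem_iUnion, mem_ball]
    constructor
    · intro hz
      obtain ⟨q, hq₁, hq₂⟩ := exists_rat_btwn hz
      exact ⟨⟨q, by exact_mod_cast dist_nonneg.trans_lt hq₁, hq₂⟩, hq₁⟩
    · rintro ⟨q, hq⟩
      exact hq.trans q.2.2
  have hdir : Directed (· ⊆ ·) fun q : {q : ℚ // 0 < q ∧ (q : ℝ) < r} => ball x (q : ℚ) := by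
    intro q q'
    rcases le_total (q : ℚ) q' with hle | hle
    · exact ⟨q', ball_subset_ball (by exact_mod_cast hle), le_rfl⟩
    · exact ⟨q, le_rfl, ball_subset_ball (by exact_mod_cast hle)⟩
  have hint : ∫⁻ z in ball x r, ‖f z - f x‖ₑ / ‖z - x‖ₑ =
      ⨆ q : {q : ℚ // 0 < q ∧ (q : ℝ) < r},
        ∫⁻ z in ball x (q : ℚ), ‖f z - f x‖ₑ / ‖z - x‖ₑ := by
    conv_lhs => rw [hball]
    exact setLIntegral_iUnion_of_directed _ hdir
  rw [meanQuotient, hint, ENNReal.mul_iSup]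
  refine iSup_le fun q => ?_
  refine le_trans ?_ (le_iSup₂ (f := fun (q : ℚ) (_ : 0 < q) => meanQuotient f q x) (q : ℚ) q.2.1)
  unfold meanQuotient
  gcongr
  exact q.2.2.le

theorem measurable_MQ {f : EuclideanSpace ℝ (Fin n) → ℝ} (hf : Measurable f) :
    Measurable (MQ f) := by
  rw [funext (MQ_eq_iSup_rat f)]
  exact Measurable.iSup fun q => Measurable.iSup fun _ => measurable_meanQuotient hf q

theorem MQ_ae_eq {f f' : EuclideanSpace ℝ (Fin n) → ℝ} (h : f =ᵐ[volume] f') :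
    MQ f =ᵐ[volume] MQ f' := by
  filter_upwards [h] with x hx
  unfold MQ meanQuotient
  refine iSup_congr fun r => iSup_congr fun _ => ?_
  congr 1
  refine lintegral_congr_ae (ae_restrict_of_ae ?_)
  filter_upwards [h] with z hz
  rw [hz, hx]

theorem aemeasurable_MQ {f : EuclideanSpace ℝ (Fin n) → ℝ} (hf : AEMeasurable f) :
    AEMeasurable (MQ f) :=
  ⟨MQ (hf.mk f), measurable_MQ hf.measurable_mk, MQ_ae_eq hf.ae_eq_mk⟩

end Lp

/-! ### Sobolev functions -/

theorem corollary3 (n : ℕ) (hn : 1 ≤ n) :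
    (∀ p : ℝ≥0∞, 1 ≤ p → ∀ f ∈ sobolevLoc n p,
      ∀ g : EuclideanSpace ℝ (Fin n) → EuclideanSpace ℝ (Fin n), HasWeakGradient f g →
        (preciseRep f =ᵐ[volume] f ∧
          ∀ x, MQ (preciseRep f) x ≤ centredMaximal (fun y => ‖g y‖) x) ∧
        (∀ x, AveragesTendTo f x (f x) → MQ f x ≤ centredMaximal (fun y => ‖g y‖) x) ∧
        (∀ᵐ x, MQ f x ≤ centredMaximal (fun y => ‖g y‖) x)) ∧
    (∀ p : ℝ≥0∞, 1 < p → sobolev n p ⊆ mqSpace n p) := by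
  have hae : ∀ (f : EuclideanSpace ℝ (Fin n) → ℝ)
      (g : EuclideanSpace ℝ (Fin n) → EuclideanSpace ℝ (Fin n)), HasWeakGradient f g →
      ∀ᵐ x, MQ f x ≤ centredMaximal (fun y => ‖g y‖) x := fun f g h => by
    filter_upwards [ae_averagesTendTo hn h.1] with x hx
    exact MQ_le_of_ae_eq hn h (ae_eq_refl f) hx
  refine ⟨fun p _ f _ g h => ⟨⟨preciseRep_ae_eq hn h.1, MQ_preciseRep_le hn h⟩,
    fun x hx => MQ_le_of_ae_eq hn h (ae_eq_refl f) hx, hae f g h⟩, ?_⟩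
  rintro p hp f ⟨hf, g, h, hg⟩
  exact ⟨hf, memLp_of_ae_le_centredMaximal hn hp hg.norm
    (aemeasurable_MQ hf.1.aemeasurable) (hae f g h)⟩
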